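/- Definitions. A Seidel matrix of order $n$ is a symmetric real $n\times n$ matrix $S$ with zero diagonal and all off-diagonal entries equal to $\pm1$; $\lambda_{\min}(S)$ denotes its smallest eigenvalue. The graph $G(S)$ has vertex set $\{1,\dots,n\}$, with $i\neq j$ adjacent if and only if $S_{ij}=-1$. For $U\subseteq\{1,\dots,n\}$ let $D_U$ be the diagonal matrix with $(D_U)_{ii}=1$ if $i\in U$ and $(D_U)_{ii}=-1$ otherwise. The switching class $[S]$ is the set of all graphs $G(D_USD_U)$ with $U\subseteq\{1,\dots,n\}$. The switching graph $\mathcal{S}w(S)$ is the graph of the Seidel matrix $\begin{pmatrix}S&-S+I\\-S+I&S\end{pmatrix}$ of order $2n$, and $\alpha([S])$ and $\omega([S])$ denote the independence number and the clique number of $\mathcal{S}w(S)$. Theorem. Let $S$ be a Seidel matrix of order $n\ge 277$ with $\lambda_{\min}(S)=-5$, $\alpha([S])\le 28$ and $\omega([S])=4$. Let $H$ be a graph in $[S]$ and let $x_1,x_2$ be adjacent vertices of $H$ with no common neighbours in $H$. Let the gallery $\mathcal{G}a(x_1,x_2)$ be the subgraph of $H$ induced on the set of the vertices of $H$ that are adjacent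 neither to $x_1$ nor to $x_2$; let $\kappa$ be its number of vertices, let $b_y$ be the valency of a vertex $y$ in $\mathcal{G}a(x_1,x_2)$, and let $b_{\max}$ be the maximum valency of $\mathcal{G}a(x_1,x_2)$. If $b_{\max}\le 20$, then: (i) $\kappa\le 105$; (ii) if $\kappa=105$, then there is an edge $uv$ of $\mathcal{G}a(x_1,x_2)$ with $b_u=b_v=20$. -/

import Mathlib

/-- A Seidel matrix indexed by `V`: a real symmetric matrix with `0` on the diagonal and `±1`
off the diagonal. -/
structure SeidelMatrix (V : Type*) where
  /-- the underlying real matrix -/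
  toMatrix : Matrix V V ℝ
  symm : toMatrix.IsSymm
  diag_eq_zero : ∀ i, toMatrix i i = 0
  off_diag : ∀ i j, i ≠ j → toMatrix i j = 1 ∨ toMatrix i j = -1

namespace SeidelMatrix

variable {V : Type*}

/-- The graph `G(S)` of a Seidel matrix `S`: `i` and `j` are adjacent iff `S i j = -1`. -/
def graph (S : SeidelMatrix V) : SimpleGraph V where
  Adj i j := S.toMatrix i j = -1
  symm := ⟨fun i j h => by rw [S.symm.apply i j]; exact h⟩
  loopless := ⟨fun i h => by rw [S.diag_eq_zero i] at h; norm_num at h⟩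

/-- The diagonal matrix `D_U`, with entry `1` at `i ∈ U` and `-1` at `i ∉ U`. -/
def switchDiag [DecidableEq V] (U : Finset V) : Matrix V V ℝ :=
  Matrix.diagonal fun i => if i ∈ U then 1 else -1

/-- Switching: the Seidel matrix `D_U * S * D_U`. -/
def switch [Fintype V] [DecidableEq V] (S : SeidelMatrix V) (U : Finset V) : SeidelMatrix V where
  toMatrix := switchDiag U * S.toMatrix * switchDiag U
  symm := by
    ext i j
    simp only [switchDiag, Matrix.transpose_apply, Matrix.mul_diagonal, Matrix.diagonal_mul]
    rw [S.symm.apply i j]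
    ring
  diag_eq_zero i := by
    simp [switchDiag, Matrix.mul_diagonal, Matrix.diagonal_mul, S.diag_eq_zero i]
  off_diag i j hij := by
    simp only [switchDiag, Matrix.mul_diagonal, Matrix.diagonal_mul]
    rcases S.off_diag i j hij with h | h <;> rw [h] <;> split_ifs <;> norm_num

/-- The switching class `[S]`: all graphs obtained from `G(S)` by switching. -/
def switchingClass [Fintype V] [DecidableEq V] (S : SeidelMatrix V) : Set (SimpleGraph V) :=
  {H | ∃ U : Finset V, H = (S.switch U).graph}

/-- The Seidel matrix `[[S, -S + I], [-S + I, S]]` of the switching graph. -/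
def double [DecidableEq V] (S : SeidelMatrix V) : SeidelMatrix (V ⊕ V) where
  toMatrix := Matrix.fromBlocks S.toMatrix (-S.toMatrix + 1) (-S.toMatrix + 1) S.toMatrix
  symm := by
    have h : (-S.toMatrix + 1).transpose = -S.toMatrix + 1 := by
      rw [Matrix.transpose_add, Matrix.transpose_neg, S.symm.eq, Matrix.transpose_one]
    exact Matrix.IsSymm.fromBlocks S.symm h S.symm
  diag_eq_zero i := by
    rcases i with i | i <;> simp [S.diag_eq_zero i]
  off_diag i j hij := by
    have key : ∀ a b : V, (-S.toMatrix + 1) a b = 1 ∨ (-S.toMatrix + 1) a b = -1 := by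
      intro a b
      by_cases hab : a = b
      · subst hab
        simp [S.diag_eq_zero a]
      · rcases S.off_diag a b hab with h | h <;> simp [h, hab]
    rcases i with i | i <;> rcases j with j | j
    · exact S.off_diag i j fun h => hij (by rw [h])
    · exact key i j
    · exact key i j
    · exact S.off_diag i j fun h => hij (by rw [h])

/-- The switching graph `Sw(S)`. -/
def switchingGraph [DecidableEq V] (S : SeidelMatrix V) : SimpleGraph (V ⊕ V) :=
  S.double.graph

/-- The independence number `α([S])`, i.e. that of the switching graph. -/
noncomputable def indepNum [DecidableEq V] (S : SeidelMatrix V) : ℕ :=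
  S.switchingGraph.indepNum

/-- The clique number `ω([S])`, i.e. that of the switching graph. -/
noncomputable def cliqueNum [DecidableEq V] (S : SeidelMatrix V) : ℕ :=
  S.switchingGraph.cliqueNum

/-- `μ` is the smallest eigenvalue `λ_min(S)` of `S`. -/
def IsSmallestEigenvalue [Fintype V] [DecidableEq V] (S : SeidelMatrix V) (μ : ℝ) : Prop :=
  IsLeast {r : ℝ | Module.End.HasEigenvalue (Matrix.toLin' S.toMatrix) r} μ

end SeidelMatrix

/-- The set `U(x₁, x₂)` of the vertices of `H` adjacent neither to `x₁` nor to `x₂`. -/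
def gallerySet {V : Type*} [Fintype V] (H : SimpleGraph V) [DecidableRel H.Adj] (x₁ x₂ : V) :
    Finset V :=
  Finset.univ.filter fun y => ¬ H.Adj y x₁ ∧ ¬ H.Adj y x₂

/-- The gallery `Ga(x₁, x₂)`: the subgraph of `H` induced on `U(x₁, x₂)`. -/
abbrev gallery {V : Type*} [Fintype V] (H : SimpleGraph V) [DecidableRel H.Adj] (x₁ x₂ : V) :
    SimpleGraph (gallerySet H x₁ x₂ : Set V) :=
  H.induce (gallerySet H x₁ x₂ : Set V)

/-! Even 105 gallery vertices are impossible, which settles both claims at once. Pick exactly 105 of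
them and let `G` be the induced graph. It is triangle-free: a triangle, together with the opposite
copies of `x₁` and `x₂`, would be a 5-clique of the switching graph. Its independent sets have at
most 27 elements, since `x₁` can be added to each, and its degrees are at most 20. Positive
semidefiniteness of `S + 5I`, tested with optimal weights on `x₁` and `x₂`, says that the adjacency
form of `G` is at most 2|f|² + (∑ f)²/4.

Let D be the degree sum, θ the top eigenvalue and z the projection of the all-one vector onto a top
eigenvector, so that ∑ z = |z|² = S. Three facts collide. Shearer's bound turns the small
independence number into D ≥ 574 (`exists_isIndepSet_sum_le`), and hence θ ≥ D/105 > 27/5. The form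
bound on the span of 1 and z bounds D above in terms of θ and S. On the complement of z the form is
at most 2, and triangle-freeness then makes z(w)² large at vertices w of large degree
(`mul_degree_le_of_eigenvector`).

For θ ≥ 10 a second-moment computation with the degrees is contradictory; for θ ≤ 10 one sums a
quadratic inequality, valid at every vertex, against the moments ∑ z², ∑ d z and ∑ d. -/

namespace SimpleGraph

/-! ### Shearer's bound for convex sequences -/

variable {V : Type*} (G : SimpleGraph V) [DecidableRel G.Adj]

theorem sum_sum_filter_adj_comm (s : Finset V) (h : V → V → ℝ) :
    ∑ v ∈ s, ∑ u ∈ s with G.Adj v u, h v u = ∑ u ∈ s, ∑ v ∈ s with G.Adj u v, h v u := by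
  simp only [Finset.sum_filter]
  rw [Finset.sum_comm]
  simp only [G.adj_comm]

/-- Convexity: lowering the degree `d` step by step, each step gains at least as much as the first
one. -/
theorem card_mul_sub_le_of_antitone_sub {f : ℕ → ℝ} (hf : Antitone fun d => f d - f (d + 1))
    (d n : ℕ) (h : n ≤ d) : f d + n * (f (d - 1) - f (d - 1 + 1)) ≤ f (d - n) := by
  induction n with
  | zero => simp
  | succ n ih =>
    have h1 := ih (by omega)
    have h2 := hf (show d - (n + 1) ≤ d - 1 by omega)
    have h3 : d - (n + 1) + 1 = d - n := by omega
    simp only [h3] at h2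
    push_cast
    linarith

/-- Shearer's lower bound for the independence number of a triangle-free graph, in the form
`∑ v, f (deg v) ≤ α` for a convex sequence `f` satisfying Shearer's recursive inequality. -/
theorem exists_isIndepSet_sum_le [DecidableEq V] (hG : G.CliqueFree 3) {f : ℕ → ℝ}
    (hf : Antitone fun d => f d - f (d + 1))
    (hrec : ∀ d : ℕ, (d + 1) * f d ≤ 1 + d * (d - 1) * (f (d - 1) - f (d - 1 + 1)))
    (s : Finset V) :
    ∃ I ⊆ s, G.IsIndepSet (I : Set V) ∧ ∑ v ∈ s, f (s.filter (G.Adj v)).card ≤ I.card := by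
  induction s using Finset.strongInduction with
  | H s ih =>
  rcases s.eq_empty_or_nonempty with rfl | hs
  · exact ⟨∅, by simp, by simp [IsIndepSet], by simp⟩
  set N : V → Finset V := fun v => s.filter (G.Adj v) with hN
  set d : V → ℕ := fun v => (N v).card with hd
  -- Truncated subtraction makes `E 0 = E 1`, which keeps `E` antitone at 0 as well.
  set E : ℕ → ℝ := fun k => f (k - 1) - f (k - 1 + 1) with hE
  have hEanti : Antitone E := fun a b hab => hf (show a - 1 ≤ b - 1 by omega)
  have hNmem : ∀ {v w}, w ∈ N v ↔ w ∈ s ∧ G.Adj v w := by simp [hN]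
  -- A lower bound for the change of 1 + ∑ f(deg) when `v` is put into the independent set and its
  -- closed neighbourhood is deleted. Its average over `v` is shown nonnegative, so some `v` allows
  -- the induction.
  set gain : V → ℝ := fun v => 1 - f (d v) - ∑ u ∈ N v, f (d u) +
    ∑ u ∈ N v, (∑ w ∈ N u, E (d w) - E (d v)) with hgain
  have swap := G.sum_sum_filter_adj_comm s
  have hsum : 0 ≤ ∑ v ∈ s, gain v := by
    have e1 : ∑ v ∈ s, ∑ u ∈ N v, f (d u) = ∑ u ∈ s, d u * f (d u) := by
      rw [swap fun _ u => f (d u)]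
      exact Finset.sum_congr rfl fun u _ => by simp [hd, hN]
    have e2 : ∑ v ∈ s, ∑ u ∈ N v, ∑ w ∈ N u, E (d w) = ∑ u ∈ s, ∑ w ∈ N u, d u * E (d w) := by
      rw [swap fun _ u => ∑ w ∈ N u, E (d w)]
      exact Finset.sum_congr rfl fun u _ => by
        rw [Finset.sum_const, nsmul_eq_mul, ← Finset.mul_sum]
    have e3 : ∑ v ∈ s, ∑ u ∈ N v, E (d v) = ∑ v ∈ s, d v * E (d v) :=
      Finset.sum_congr rfl fun v _ => by simp [hd]
    have e4 : ∑ u ∈ s, (d u : ℝ) ^ 2 * E (d u) ≤ ∑ u ∈ s, ∑ w ∈ N u, d u * E (d w) := by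
      have h1 : ∑ u ∈ s, ∑ w ∈ N u, d u * E (d u) = ∑ u ∈ s, (d u : ℝ) ^ 2 * E (d u) :=
        Finset.sum_congr rfl fun u _ => by simp [hd]; ring
      have h2 : ∑ u ∈ s, ∑ w ∈ N u, (d u : ℝ) * E (d w) = ∑ u ∈ s, ∑ w ∈ N u, d w * E (d u) :=
        swap fun u w => (d u : ℝ) * E (d w)
      have h3 : ∑ u ∈ s, ∑ w ∈ N u, (d u : ℝ) * E (d u) = ∑ u ∈ s, ∑ w ∈ N u, d w * E (d w) :=
        swap fun u _ => (d u : ℝ) * E (d u)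
      -- Chebyshev along edges: `d` and `E ∘ d` are oppositely ordered.
      have h4 : 0 ≤ ∑ u ∈ s, ∑ w ∈ N u, ((d u : ℝ) - d w) * (E (d w) - E (d u)) := by
        refine Finset.sum_nonneg fun u _ => Finset.sum_nonneg fun w _ => ?_
        rcases le_total (d u) (d w) with h | h
        · exact mul_nonneg_of_nonpos_of_nonpos (by simpa using h) (by simpa using hEanti h)
        · exact mul_nonneg (by simpa using h) (by simpa using hEanti h)
      have h5 : ∑ u ∈ s, ∑ w ∈ N u, ((d u : ℝ) - d w) * (E (d w) - E (d u)) =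
          ∑ u ∈ s, ∑ w ∈ N u, d u * E (d w) - ∑ u ∈ s, ∑ w ∈ N u, d u * E (d u)
          - ∑ u ∈ s, ∑ w ∈ N u, d w * E (d w) + ∑ u ∈ s, ∑ w ∈ N u, d w * E (d u) := by
        simp only [← Finset.sum_sub_distrib, ← Finset.sum_add_distrib]
        exact Finset.sum_congr rfl fun u _ => Finset.sum_congr rfl fun w _ => by ring
      linarith
    have e5 : ∑ v ∈ s, gain v = ∑ v ∈ s, (1 - f (d v)) - ∑ v ∈ s, ∑ u ∈ N v, f (d u) +
        (∑ v ∈ s, ∑ u ∈ N v, ∑ w ∈ N u, E (d w) - ∑ v ∈ s, ∑ u ∈ N v, E (d v)) := by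
      simp only [hgain, Finset.sum_sub_distrib, Finset.sum_add_distrib]
    have e6 : 0 ≤ ∑ v ∈ s, (1 - f (d v) - d v * f (d v) - d v * E (d v) + (d v : ℝ) ^ 2 * E (d v)) :=
      Finset.sum_nonneg fun v _ => by
        have := hrec (d v)
        simp only [hE]
        linarith
    simp only [Finset.sum_sub_distrib, Finset.sum_add_distrib] at e5 e6
    linarith
  obtain ⟨v, hv, hgv⟩ : ∃ v ∈ s, 0 ≤ gain v := by
    by_contra! h
    exact absurd (Finset.sum_lt_sum_of_nonempty hs h) (by simpa using hsum)
  have hvN : v ∉ N v := by simp [hN]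
  set s' := s \ insert v (N v) with hs'
  have hsub : insert v (N v) ⊆ s := Finset.insert_subset hv (Finset.filter_subset _ _)
  have hs's : s' ⊂ s := Finset.sdiff_ssubset hsub (Finset.insert_nonempty _ _)
  obtain ⟨I, hIs, hI, hcard⟩ := ih s' hs's
  have hvI : v ∉ I := fun h => by simpa [hs'] using hIs h
  have hmem' : ∀ {w}, w ∈ s' ↔ w ∈ s ∧ w ≠ v ∧ ¬ G.Adj v w := by
    intro w
    simp only [hs', Finset.mem_sdiff, Finset.mem_insert, hNmem]
    tauto
  refine ⟨insert v I, Finset.insert_subset hv (hIs.trans hs's.subset), ?_, ?_⟩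
  · rw [Finset.coe_insert]
    refine Set.pairwise_insert.2 ⟨hI, fun w hw _ => ?_⟩
    have h := (hmem'.1 (hIs hw)).2.2
    exact ⟨h, fun h' => h h'.symm⟩
  · rw [Finset.card_insert_of_notMem hvI]
    have hdeg : ∀ w ∈ s', f (d w) + (((N v).filter (G.Adj w)).card : ℝ) * E (d w) ≤
        f (s'.filter (G.Adj w)).card := by
      intro w hw
      have hw' := hmem'.1 hw
      have h1 : s'.filter (G.Adj w) = N w \ (N v).filter (G.Adj w) := by
        ext x
        simp only [Finset.mem_filter, hmem', Finset.mem_sdiff, hNmem]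
        constructor
        · rintro ⟨⟨h1, h2, h3⟩, h4⟩
          exact ⟨⟨h1, h4⟩, fun h => h3 h.1.2⟩
        · rintro ⟨⟨h1, h2⟩, h3⟩
          refine ⟨⟨h1, ?_, fun h => h3 ⟨⟨h1, h⟩, h2⟩⟩, h2⟩
          rintro rfl
          exact hw'.2.2 h2.symm
      have h2 : (N v).filter (G.Adj w) ⊆ N w := by
        intro x
        simp only [Finset.mem_filter, hNmem]
        tauto
      rw [h1, Finset.card_sdiff_of_subset h2]
      exact card_mul_sub_le_of_antitone_sub hf _ _ (Finset.card_le_card h2)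
    have hcount : ∑ w ∈ s', (((N v).filter (G.Adj w)).card : ℝ) * E (d w) =
        ∑ u ∈ N v, (∑ w ∈ N u, E (d w) - E (d v)) := by
      have h1 : ∀ w, (((N v).filter (G.Adj w)).card : ℝ) * E (d w) =
          ∑ u ∈ N v, if G.Adj w u then E (d w) else 0 := fun w => by
        rw [← Finset.sum_filter, Finset.sum_const, nsmul_eq_mul]
      simp only [h1]
      rw [Finset.sum_comm]
      refine Finset.sum_congr rfl fun u hu => ?_
      have hu' := hNmem.1 hu
      rw [← Finset.sum_filter, eq_sub_iff_add_eq]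
      -- Triangle-freeness: every neighbour of `u` except `v` itself survives the deletion.
      have h2 : insert v (s'.filter fun w => G.Adj w u) = N u := by
        ext w
        simp only [Finset.mem_insert, Finset.mem_filter, hmem', hNmem]
        constructor
        · rintro (rfl | h)
          · exact ⟨hv, hu'.2.symm⟩
          · exact ⟨h.1.1, h.2.symm⟩
        · rintro ⟨h1, h2⟩
          by_cases hwv : w = v
          · exact Or.inl hwv
          · refine Or.inr ⟨⟨h1, hwv, fun h => ?_⟩, h2.symm⟩
            exact hG {v, u, w} (is3Clique_triple_iff.2 ⟨hu'.2, h, h2⟩)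
      rw [← h2, Finset.sum_insert (by simp [hmem']), add_comm]
    have hsplit : ∑ w ∈ s, f (d w) = ∑ w ∈ s', f (d w) + (f (d v) + ∑ u ∈ N v, f (d u)) := by
      rw [← Finset.sum_sdiff hsub, Finset.sum_insert hvN]
    have hle := Finset.sum_le_sum hdeg
    rw [Finset.sum_add_distrib, hcount] at hle
    push_cast
    simp only [hgain] at hgv
    change ∑ w ∈ s, f (d w) ≤ _
    linarith

end SimpleGraph

/-! ### Polynomial and pointwise inequalities for θ ≤ 10 -/

/-- The six bounds cover the degree cases d ≤ 4, d = 5, d = 20 at the two extreme degree sums D =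
574 (left) and D = 105θ (right). Convexity in D and in d then gives everything between. -/
theorem quadratic_bound_small_left {θ : ℝ} (h₁ : 27 / 5 ≤ θ) (h₂ : θ ≤ 10) :
    (θ ^ 2 + 574 / 42) ^ 2 * (64 / 25 * (θ - 2)) <
      1 / 42 * θ ^ 4 * (574 - 210 + 126 * (θ - 2) + 36 / 25 * (θ - 2) ^ 2) := by
  obtain ⟨x, hx, rfl⟩ : ∃ x, 0 ≤ x ∧ θ = (27 + x) / 5 := ⟨5 * θ - 27, by linarith, by ring⟩
  obtain ⟨y, hy⟩ : ∃ y, y = 10 - (27 + x) / 5 := ⟨_, rfl⟩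
  have hy0 : 0 ≤ y := by linarith
  rw [← sub_pos]
  -- Bernstein-type certificate: homogenized with x + 5y = 23, the difference has only positive
  -- coefficients in x and y.
  refine lt_of_lt_of_eq (b := 10218673601/233156525175 * y ^ 6
      + 60601010569/233156525175 * x * y ^ 5
      + 16338424034/46631305035 * x ^ 2 * y ^ 4
      + 16149564472/77718841725 * x ^ 3 * y ^ 3
      + 14614188704/233156525175 * x ^ 4 * y ^ 2
      + 314817392/33308075025 * x ^ 5 * y
      + 132308896/233156525175 * x ^ 6) ?_ (by subst hy; ring)
  rcases hx.eq_or_lt with rfl | hx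
  · have : 0 < y := by linarith
    positivity
  · positivity

theorem quadratic_bound_five_left {θ : ℝ} (h₁ : 27 / 5 ≤ θ) (h₂ : θ ≤ 10) :
    (θ ^ 2 + 574 / 42) ^ 2 * (5 * (θ ^ 2 + 5 * θ + 5) * (64 / 25 * (θ - 2)) * (2 * (θ - 2))) <
      20 / 9 * ((θ - 2) * (θ ^ 2 + 5 * θ + 5) / 21 + 4 / 9 * θ ^ 2) * θ ^ 4 *
        (574 - 210 + 126 * (θ - 2) + 36 / 25 * (θ - 2) ^ 2) := by
  obtain ⟨x, hx, rfl⟩ : ∃ x, 0 ≤ x ∧ θ = (27 + x) / 5 := ⟨5 * θ - 27, by linarith, by ring⟩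
  obtain ⟨y, hy⟩ : ∃ y, y = 10 - (27 + x) / 5 := ⟨_, rfl⟩
  have hy0 : 0 ≤ y := by linarith
  rw [← sub_pos]
  refine lt_of_lt_of_eq (b := 1078979635900456/567363088360845 * y ^ 9
      + 379933885032704/63040343151205 * x * y ^ 8
      + 954991797558592/113472617672169 * x ^ 2 * y ^ 7
      + 3816694358038664/567363088360845 * x ^ 3 * y ^ 6
      + 5724327990437584/1702089265082535 * x ^ 4 * y ^ 5
      + 368241402235456/340417853016507 * x ^ 5 * y ^ 4
      + 1132106784245888/5106267795247605 * x ^ 6 * y ^ 3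
      + 46870783532032/1702089265082535 * x ^ 7 * y ^ 2
      + 625423510784/340417853016507 * x ^ 8 * y
      + 48887711744/1021253559049521 * x ^ 9) ?_ (by subst hy; ring)
  rcases hx.eq_or_lt with rfl | hx
  · have : 0 < y := by linarith
    positivity
  · positivity

theorem quadratic_bound_twenty_left {θ : ℝ} (h₁ : 27 / 5 ≤ θ) (h₂ : θ ≤ 10) :
    (θ ^ 2 + 574 / 42) ^ 2 * (20 * (θ ^ 2 + 20 * θ + 20) * (64 / 25 * (θ - 2)) * (2 * (θ - 2))) <
      20 / 9 * ((θ - 2) * (θ ^ 2 + 20 * θ + 20) / 21 + 64 / 9 * θ ^ 2) * θ ^ 4 *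
        (574 - 210 + 126 * (θ - 2) + 36 / 25 * (θ - 2) ^ 2) := by
  obtain ⟨x, hx, rfl⟩ : ∃ x, 0 ≤ x ∧ θ = (27 + x) / 5 := ⟨5 * θ - 27, by linarith, by ring⟩
  obtain ⟨y, hy⟩ : ∃ y, y = 10 - (27 + x) / 5 := ⟨_, rfl⟩
  have hy0 : 0 ≤ y := by linarith
  rw [← sub_pos]
  refine lt_of_lt_of_eq (b := 9034691283615496/567363088360845 * y ^ 9
      + 3074580039669896/63040343151205 * x * y ^ 8
      + 37435724278015184/567363088360845 * x ^ 2 * y ^ 7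
      + 5774747996759872/113472617672169 * x ^ 3 * y ^ 6
      + 41341222658388736/1702089265082535 * x ^ 4 * y ^ 5
      + 2489202451682176/340417853016507 * x ^ 5 * y ^ 4
      + 6907513954303232/5106267795247605 * x ^ 6 * y ^ 3
      + 239106708164608/1702089265082535 * x ^ 7 * y ^ 2
      + 2141241737216/340417853016507 * x ^ 8 * y
      + 4710662144/1021253559049521 * x ^ 9) ?_ (by subst hy; ring)
  rcases hx.eq_or_lt with rfl | hx
  · have : 0 < y := by linarith
    positivity
  · positivity

theorem quadratic_bound_small_right {θ : ℝ} (h₁ : 27 / 5 ≤ θ) (h₂ : θ ≤ 10) :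
    (θ ^ 2 + (105 * θ) / 42) ^ 2 * (64 / 25 * (θ - 2)) <
      1 / 42 * θ ^ 4 * ((105 * θ) - 210 + 126 * (θ - 2) + 36 / 25 * (θ - 2) ^ 2) := by
  obtain ⟨x, hx, rfl⟩ : ∃ x, 0 ≤ x ∧ θ = (27 + x) / 5 := ⟨5 * θ - 27, by linarith, by ring⟩
  obtain ⟨y, hy⟩ : ∃ y, y = 10 - (27 + x) / 5 := ⟨_, rfl⟩
  have hy0 : 0 ≤ y := by linarith
  rw [← sub_pos]
  refine lt_of_lt_of_eq (b := 94521411/2252720050 * y ^ 6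
      + 631222659/2252720050 * x * y ^ 5
      + 93556292/225272005 * x ^ 2 * y ^ 4
      + 61002196/225272005 * x ^ 3 * y ^ 3
      + 4039880/45054401 * x ^ 4 * y ^ 2
      + 95080/6436343 * x ^ 5 * y
      + 43200/45054401 * x ^ 6) ?_ (by subst hy; ring)
  rcases hx.eq_or_lt with rfl | hx
  · have : 0 < y := by linarith
    positivity
  · positivity

theorem quadratic_bound_five_right {θ : ℝ} (h₁ : 27 / 5 ≤ θ) (h₂ : θ ≤ 10) :
    (θ ^ 2 + (105 * θ) / 42) ^ 2 * (5 * (θ ^ 2 + 5 * θ + 5) * (64 / 25 * (θ - 2)) * (2 * (θ - 2))) <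
      20 / 9 * ((θ - 2) * (θ ^ 2 + 5 * θ + 5) / 21 + 4 / 9 * θ ^ 2) * θ ^ 4 *
        ((105 * θ) - 210 + 126 * (θ - 2) + 36 / 25 * (θ - 2) ^ 2) := by
  obtain ⟨x, hx, rfl⟩ : ∃ x, 0 ≤ x ∧ θ = (27 + x) / 5 := ⟨5 * θ - 27, by linarith, by ring⟩
  obtain ⟨y, hy⟩ : ∃ y, y = 10 - (27 + x) / 5 := ⟨_, rfl⟩
  have hy0 : 0 ≤ y := by linarith
  rw [← sub_pos]
  refine lt_of_lt_of_eq (b := 116843300746884/63040343151205 * y ^ 9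
      + 412124818761504/63040343151205 * x * y ^ 8
      + 128685723837368/12608068630241 * x ^ 2 * y ^ 7
      + 581015680679772/63040343151205 * x ^ 3 * y ^ 6
      + 600075212557600/113472617672169 * x ^ 4 * y ^ 5
      + 226405790515840/113472617672169 * x ^ 5 * y ^ 4
      + 168279822135680/340417853016507 * x ^ 6 * y ^ 3
      + 26378337208000/340417853016507 * x ^ 7 * y ^ 2
      + 2373071104000/340417853016507 * x ^ 8 * y
      + 93370880000/340417853016507 * x ^ 9) ?_ (by subst hy; ring)
  rcases hx.eq_or_lt with rfl | hx
  · have : 0 < y := by linarith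
    positivity
  · positivity

theorem quadratic_bound_twenty_right {θ : ℝ} (h₁ : 27 / 5 ≤ θ) (h₂ : θ ≤ 10) :
    (θ ^ 2 + (105 * θ) / 42) ^ 2 * (20 * (θ ^ 2 + 20 * θ + 20) * (64 / 25 * (θ - 2)) * (2 * (θ - 2))) <
      20 / 9 * ((θ - 2) * (θ ^ 2 + 20 * θ + 20) / 21 + 64 / 9 * θ ^ 2) * θ ^ 4 *
        ((105 * θ) - 210 + 126 * (θ - 2) + 36 / 25 * (θ - 2) ^ 2) := by
  obtain ⟨x, hx, rfl⟩ : ∃ x, 0 ≤ x ∧ θ = (27 + x) / 5 := ⟨5 * θ - 27, by linarith, by ring⟩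
  obtain ⟨y, hy⟩ : ∃ y, y = 10 - (27 + x) / 5 := ⟨_, rfl⟩
  have hy0 : 0 ≤ y := by linarith
  rw [← sub_pos]
  refine lt_of_lt_of_eq (b := 974549693175444/63040343151205 * y ^ 9
      + 3386250046528596/63040343151205 * x * y ^ 8
      + 5227701491826976/63040343151205 * x ^ 2 * y ^ 7
      + 4665612886462944/63040343151205 * x ^ 3 * y ^ 6
      + 4744755864842944/113472617672169 * x ^ 4 * y ^ 5
      + 1751678937337408/113472617672169 * x ^ 5 * y ^ 4
      + 1263203930216960/340417853016507 * x ^ 6 * y ^ 3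
      + 190080037273600/340417853016507 * x ^ 7 * y ^ 2
      + 16203360256000/340417853016507 * x ^ 8 * y
      + 594821120000/340417853016507 * x ^ 9) ?_ (by subst hy; ring)
  rcases hx.eq_or_lt with rfl | hx
  · have : 0 < y := by linarith
    positivity
  · positivity

/-- A convex quadratic inequality that holds at the ends of an interval holds inside it. -/
theorem mul_add_div_sq_lt_of_endpoints {a X Y b l r D : ℝ} (hX : 0 ≤ X)
    (hl : (a + l / 42) ^ 2 * X < Y * (l + b)) (hr : (a + r / 42) ^ 2 * X < Y * (r + b))
    (hlD : l ≤ D) (hDr : D ≤ r) : (a + D / 42) ^ 2 * X < Y * (D + b) := by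
  rcases (hlD.trans hDr).eq_or_lt with rfl | hlr
  · obtain rfl := le_antisymm hDr hlD
    exact hl
  have h1 : (r - l) * (Y * (D + b) - (a + D / 42) ^ 2 * X) =
      (r - D) * (Y * (l + b) - (a + l / 42) ^ 2 * X) +
      (D - l) * (Y * (r + b) - (a + r / 42) ^ 2 * X) +
      X / 42 ^ 2 * ((D - l) * (r - D)) * (r - l) := by ring
  have h2 : 0 ≤ X / 42 ^ 2 * ((D - l) * (r - D)) * (r - l) := by
    have := mul_nonneg (sub_nonneg.2 hlD) (sub_nonneg.2 hDr)
    have := sub_pos.2 hlr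
    positivity
  have h3 : 0 < (r - D) * (Y * (l + b) - (a + l / 42) ^ 2 * X) +
      (D - l) * (Y * (r + b) - (a + r / 42) ^ 2 * X) := by
    have h4 := mul_nonneg (sub_nonneg.2 hlD) (sub_pos.2 hr).le
    have h5 := mul_nonneg (sub_nonneg.2 hDr) (sub_pos.2 hl).le
    rcases hDr.eq_or_lt with rfl | hDr
    · have := mul_pos (sub_pos.2 hlr) (sub_pos.2 hr)
      linarith
    · have := mul_pos (sub_pos.2 hDr) (sub_pos.2 hl)
      linarith
  have h6 : 0 < (r - l) * (Y * (D + b) - (a + D / 42) ^ 2 * X) := by linarith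
  exact sub_pos.1 (pos_of_mul_pos_right h6 (sub_pos.2 hlr).le)

/-- Pointwise inequality for vertices of small degree. -/
theorem quadratic_nonneg_of_le_four {θ z d e m : ℝ} (hd0 : 0 ≤ d) (hd : d ≤ 4) (hm : m ^ 2 ≤ e) :
    0 ≤ θ ^ 2 * z ^ 2 - m * (d * z) * θ + e * d := by
  nlinarith [sq_nonneg (2 * θ * z - m * d), mul_le_mul_of_nonneg_left hm hd0,
    mul_nonneg (mul_nonneg hd0 (sub_nonneg.2 hd)) (sq_nonneg m)]

/-- Pointwise inequality for vertices of large degree, from the local inequality at the vertex. -/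
theorem quadratic_nonneg_of_five_le {θ z d e m S : ℝ} (hθ : 2 < θ) (hd : 5 ≤ d) (hd' : d ≤ 20)
    (h5 : m ^ 2 * (5 * (θ ^ 2 + 5 * θ + 5) * (2 * (θ - 2))) ≤
      20 / 9 * (2 * (θ - 2) * e * (θ ^ 2 + 5 * θ + 5) + 4 / 9 * θ ^ 2 * S))
    (h20 : m ^ 2 * (20 * (θ ^ 2 + 20 * θ + 20) * (2 * (θ - 2))) ≤
      20 / 9 * (2 * (θ - 2) * e * (θ ^ 2 + 20 * θ + 20) + 64 / 9 * θ ^ 2 * S))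
    (hloc : S * (d * (d - 4)) ≤ 2 * (θ - 2) * (θ ^ 2 + d * θ + d) * z ^ 2) :
    0 ≤ θ ^ 2 * z ^ 2 - m * (d * z) * θ + e * d := by
  have hT : 0 < 2 * (θ - 2) * (θ ^ 2 + d * θ + d) := by
    have : 0 < θ - 2 := by linarith
    positivity
  have hq : m ^ 2 * (d * (θ ^ 2 + d * θ + d) * (2 * (θ - 2))) ≤
      20 / 9 * (2 * (θ - 2) * e * (θ ^ 2 + d * θ + d) + 4 / 9 * (d - 4) * θ ^ 2 * S) := by
    -- The left side of the goal is a convex quadratic in d and the right side is linear, so d = 5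
    -- and d = 20 suffice.
    have h1 := mul_le_mul_of_nonneg_left h5 (sub_nonneg.2 hd')
    have h2 := mul_le_mul_of_nonneg_left h20 (sub_nonneg.2 hd)
    have h3 : 0 ≤ 15 * (2 * (θ - 2)) * m ^ 2 * (θ + 1) * ((d - 5) * (20 - d)) := by
      have := mul_nonneg (sub_nonneg.2 hd) (sub_nonneg.2 hd')
      have : 0 < θ - 2 := by linarith
      positivity
    linarith
  -- Of θ²z², the share 5/9 completes the square and the share 4/9 is bounded below by `hloc`.
  have key : 20 / 9 * (2 * (θ - 2) * (θ ^ 2 + d * θ + d)) *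
      (θ ^ 2 * z ^ 2 - m * (d * z) * θ + e * d) =
      2 * (θ - 2) * (θ ^ 2 + d * θ + d) * (10 / 9 * θ * z - m * d) ^ 2 +
      80 / 81 * θ ^ 2 * (2 * (θ - 2) * (θ ^ 2 + d * θ + d) * z ^ 2 - S * (d * (d - 4))) +
      d * (20 / 9 * (2 * (θ - 2) * e * (θ ^ 2 + d * θ + d) + 4 / 9 * (d - 4) * θ ^ 2 * S) -
        m ^ 2 * (d * (θ ^ 2 + d * θ + d) * (2 * (θ - 2)))) := by ring
  have h4 : 0 ≤ 80 / 81 * θ ^ 2 *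
      (2 * (θ - 2) * (θ ^ 2 + d * θ + d) * z ^ 2 - S * (d * (d - 4))) :=
    mul_nonneg (by positivity) (sub_nonneg.2 hloc)
  have h5 := mul_nonneg (by linarith : 0 ≤ d) (sub_nonneg.2 hq)
  have h6 := mul_nonneg hT.le (sq_nonneg (10 / 9 * θ * z - m * d))
  refine nonneg_of_mul_nonneg_right (a := 20 / 9 * (2 * (θ - 2) * (θ ^ 2 + d * θ + d))) ?_
    (by positivity)
  rw [key]
  linarith

/-! ### Contradictions from the moments of degrees and eigenvector -/

section Moments

variable {W : Type*} [Fintype W] {d z : W → ℝ} {θ S : ℝ}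

/-- Summing the local inequality bounds ∑ d² above; a sum of squares comparing d with an affine
function of z bounds it below. With the span bound on D these leave a cubic in θ of the wrong sign.
-/
theorem not_ten_le_of_moments (hK : Fintype.card W = 105)
    (hd : ∀ w, 0 ≤ d w ∧ d w ≤ 20) (hS : 0 < S) (hz : ∑ w, z w = S) (hzz : ∑ w, z w ^ 2 = S)
    (hdz : ∑ w, d w * z w = θ * S)
    (hloc : ∀ w, S * (d w * (d w - 4)) ≤ 2 * (θ - 2) * (θ ^ 2 + d w * θ + d w) * z w ^ 2)
    (hglob : ∀ t : ℝ, ∑ w, d w ≤ θ * S + 2 * (105 - S) -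
      (θ - 2) * (2 * t * (105 - S) - t ^ 2 * (S - 4 * (θ - 2))))
    (h10 : 10 ≤ θ) (h20 : θ ≤ 20) : False := by
  set D := ∑ w, d w with hD
  set Q := ∑ w, d w ^ 2 with hQ
  have hQ1 : Q - 4 * D ≤ 2 * (θ - 2) * (θ ^ 2 + 20 * θ + 20) := by
    have h1 : S * (Q - 4 * D) = ∑ w, S * (d w * (d w - 4)) := by
      rw [hQ, hD, Finset.mul_sum, ← Finset.sum_sub_distrib, Finset.mul_sum]
      exact Finset.sum_congr rfl fun w _ => by ring
    have h2 : ∑ w, S * (d w * (d w - 4)) ≤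
        ∑ w, 2 * (θ - 2) * (θ ^ 2 + 20 * θ + 20) * z w ^ 2 := by
      refine Finset.sum_le_sum fun w _ => (hloc w).trans ?_
      refine mul_le_mul_of_nonneg_right ?_ (sq_nonneg _)
      refine mul_le_mul_of_nonneg_left ?_ (by linarith)
      nlinarith [hd w]
    rw [← h1, ← Finset.mul_sum, hzz, mul_comm] at h2
    exact le_of_mul_le_mul_right h2 hS
  -- The slope 3/2 (θ - 2) here and t = 1/2 in `hglob` are matched so that both D and S cancel.
  have hQ2 : 0 ≤ Q - 2 * θ * D + 105 * θ ^ 2 - 2 * (3 / 2 * (θ - 2)) * (105 * θ - D) +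
      (3 / 2 * (θ - 2)) ^ 2 * (105 - S) := by
    have h1 : 0 ≤ ∑ w, (d w - θ - 3 / 2 * (θ - 2) * (z w - 1)) ^ 2 :=
      Finset.sum_nonneg fun w _ => sq_nonneg _
    have h2 : ∑ w, (d w - θ - 3 / 2 * (θ - 2) * (z w - 1)) ^ 2 =
        ∑ w, (d w ^ 2 + (θ - 6) * d w - 3 * (θ - 2) * (d w * z w) +
          (3 / 2 * (θ - 2)) ^ 2 * z w ^ 2 +
          (3 * (θ - 2) * θ - 2 * (3 / 2 * (θ - 2)) ^ 2) * z w +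
          (θ - 3 / 2 * (θ - 2)) ^ 2) := Finset.sum_congr rfl fun w _ => by ring
    rw [h2] at h1
    simp only [Finset.sum_add_distrib, Finset.sum_sub_distrib, ← Finset.mul_sum, hz, hzz, hdz,
      Finset.sum_const, Finset.card_univ, hK, nsmul_eq_mul, ← hD, ← hQ] at h1
    push_cast at h1
    linarith
  have hg := mul_le_mul_of_nonneg_left (hglob (1 / 2)) (by linarith : 0 ≤ θ - 2)
  have hp : 0 < -θ ^ 3 + 147 / 4 * θ ^ 2 - 263 * θ - 33 := by
    nlinarith [mul_nonneg (sub_nonneg.2 h10) (sub_nonneg.2 h20),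
      mul_nonneg (mul_nonneg (sub_nonneg.2 h10) (sub_nonneg.2 h20)) (sub_nonneg.2 h10)]
  linarith

/-- The form θ²z² - m d z θ + (S/42) d is nonnegative at every vertex, yet for m > m₀ its sum θ²S(m₀
- m) is negative. The constant 42 is a numerical choice for which such an m exists. -/
theorem not_le_ten_of_moments (hd : ∀ w, ∃ k : ℕ, d w = k ∧ k ≤ 20) (hS : 0 < S)
    (hzz : ∑ w, z w ^ 2 = S) (hdz : ∑ w, d w * z w = θ * S)
    (hloc : ∀ w, S * (d w * (d w - 4)) ≤ 2 * (θ - 2) * (θ ^ 2 + d w * θ + d w) * z w ^ 2)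
    (hglob : ∀ t : ℝ, ∑ w, d w ≤ θ * S + 2 * (105 - S) -
      (θ - 2) * (2 * t * (105 - S) - t ^ 2 * (S - 4 * (θ - 2))))
    (hD : 574 ≤ ∑ w, d w) (hDθ : ∑ w, d w ≤ 105 * θ) (h10 : θ ≤ 10) : False := by
  set D := ∑ w, d w with hD'
  have h54 : 27 / 5 ≤ θ := by linarith
  have hθ : 0 < θ := by linarith
  have hu : 0 < θ - 2 := by linarith
  have hN : D + (-210 + 126 * (θ - 2) + 36 / 25 * (θ - 2) ^ 2) ≤ 64 / 25 * (θ - 2) * S := by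
    have := hglob (3 / 5)
    linarith
  have bound : ∀ {X Y : ℝ}, 0 ≤ X → 0 ≤ Y →
      (θ ^ 2 + 574 / 42) ^ 2 * X < Y * (574 + (-210 + 126 * (θ - 2) + 36 / 25 * (θ - 2) ^ 2)) →
      (θ ^ 2 + 105 * θ / 42) ^ 2 * X <
        Y * (105 * θ + (-210 + 126 * (θ - 2) + 36 / 25 * (θ - 2) ^ 2)) →
      (θ ^ 2 + D / 42) ^ 2 * X < Y * (64 / 25 * (θ - 2) * S) := fun hX hY h1 h2 =>
    (mul_add_div_sq_lt_of_endpoints hX h1 h2 hD hDθ).trans_le (mul_le_mul_of_nonneg_left hN hY)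
  set m₀ := 1 + D / 42 / θ ^ 2 with hm₀
  have hm₀θ : (θ ^ 2 + D / 42) ^ 2 = m₀ ^ 2 * θ ^ 4 := by
    rw [hm₀]
    field_simp
  have hm₀pos : 0 < m₀ := by
    have : 0 ≤ D / 42 / θ ^ 2 := by positivity
    linarith
  have b4 : m₀ ^ 2 < 1 / 42 * S := by
    have := bound (X := 64 / 25 * (θ - 2)) (Y := 1 / 42 * θ ^ 4) (by positivity) (by positivity)
      (by linarith [quadratic_bound_small_left h54 h10])
      (by linarith [quadratic_bound_small_right h54 h10])
    rw [hm₀θ] at this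
    have hc : 0 < θ ^ 4 * (64 / 25 * (θ - 2)) := by positivity
    refine lt_of_mul_lt_mul_right ?_ hc.le
    linarith
  have b5 : m₀ ^ 2 * (5 * (θ ^ 2 + 5 * θ + 5) * (2 * (θ - 2))) <
      20 / 9 * (2 * (θ - 2) * (1 / 42 * S) * (θ ^ 2 + 5 * θ + 5) + 4 / 9 * θ ^ 2 * S) := by
    have := bound (X := 5 * (θ ^ 2 + 5 * θ + 5) * (64 / 25 * (θ - 2)) * (2 * (θ - 2)))
      (Y := 20 / 9 * ((θ - 2) * (θ ^ 2 + 5 * θ + 5) / 21 + 4 / 9 * θ ^ 2) * θ ^ 4)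
      (by positivity) (by positivity)
      (by linarith [quadratic_bound_five_left h54 h10])
      (by linarith [quadratic_bound_five_right h54 h10])
    rw [hm₀θ] at this
    have hc : 0 < θ ^ 4 * (64 / 25 * (θ - 2)) := by positivity
    refine lt_of_mul_lt_mul_right ?_ hc.le
    linarith
  have b20 : m₀ ^ 2 * (20 * (θ ^ 2 + 20 * θ + 20) * (2 * (θ - 2))) <
      20 / 9 * (2 * (θ - 2) * (1 / 42 * S) * (θ ^ 2 + 20 * θ + 20) + 64 / 9 * θ ^ 2 * S) := by
    have := bound (X := 20 * (θ ^ 2 + 20 * θ + 20) * (64 / 25 * (θ - 2)) * (2 * (θ - 2)))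
      (Y := 20 / 9 * ((θ - 2) * (θ ^ 2 + 20 * θ + 20) / 21 + 64 / 9 * θ ^ 2) * θ ^ 4)
      (by positivity) (by positivity)
      (by linarith [quadratic_bound_twenty_left h54 h10])
      (by linarith [quadratic_bound_twenty_right h54 h10])
    rw [hm₀θ] at this
    have hc : 0 < θ ^ 4 * (64 / 25 * (θ - 2)) := by positivity
    refine lt_of_mul_lt_mul_right ?_ hc.le
    linarith
  have c5 : 0 < 5 * (θ ^ 2 + 5 * θ + 5) * (2 * (θ - 2)) := by positivity
  have c20 : 0 < 20 * (θ ^ 2 + 20 * θ + 20) * (2 * (θ - 2)) := by positivity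
  rw [← lt_div_iff₀ c5] at b5
  rw [← lt_div_iff₀ c20] at b20
  -- Strict room above m₀² is what makes the final sum strictly negative.
  obtain ⟨M, hM, hM'⟩ := exists_between (lt_min b4 (lt_min b5 b20))
  obtain ⟨hM4, hM5, hM20⟩ : M ≤ _ ∧ M ≤ _ ∧ M ≤ _ := by
    simpa only [le_min_iff] using hM'.le
  rw [le_div_iff₀ c5] at hM5
  rw [le_div_iff₀ c20] at hM20
  have hM0 : 0 ≤ M := (sq_nonneg m₀).trans hM.le
  rw [← Real.sq_sqrt hM0] at hM4 hM5 hM20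
  have hm : m₀ < √M := Real.lt_sqrt_of_sq_lt hM
  have hpt : ∀ w, 0 ≤ θ ^ 2 * z w ^ 2 - √M * (d w * z w) * θ + 1 / 42 * S * d w := by
    intro w
    obtain ⟨k, hk, hk20⟩ := hd w
    -- Integrality of the degree is used here: nothing is needed between 4 and 5.
    rcases Nat.lt_or_ge k 5 with h | h
    · refine quadratic_nonneg_of_le_four (by simp [hk]) ?_ hM4
      rw [hk]
      exact_mod_cast Nat.lt_succ_iff.1 h
    · refine quadratic_nonneg_of_five_le (by linarith) ?_ ?_ hM5 hM20 (hloc w)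
      · rw [hk]; exact_mod_cast h
      · rw [hk]; exact_mod_cast hk20
  have hsum := Finset.sum_nonneg fun w (_ : w ∈ Finset.univ) => hpt w
  simp only [Finset.sum_add_distrib, Finset.sum_sub_distrib, ← Finset.mul_sum, ← Finset.sum_mul,
    hzz, hdz, ← hD'] at hsum
  have h1 : θ ^ 2 * S - √M * (θ * S) * θ + 1 / 42 * S * D = θ ^ 2 * S * (m₀ - √M) := by
    rw [hm₀]
    field_simp
    ring
  rw [h1] at hsum
  have h2 : θ ^ 2 * S * (m₀ - √M) < 0 := mul_neg_of_pos_of_neg (by positivity) (by linarith)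
  linarith

end Moments

/-! ### Top eigenvector and the local inequality at a vertex -/

open Matrix in
/-- A real symmetric matrix has an eigenvector whose eigenvalue bounds the quadratic form. -/
theorem Matrix.IsHermitian.exists_eigenvector_forall_dotProduct_mulVec_le {n : Type*} [Fintype n]
    [DecidableEq n] [Nonempty n] {A : Matrix n n ℝ} (hA : A.IsHermitian) :
    ∃ (θ : ℝ) (φ : n → ℝ), φ ≠ 0 ∧ A *ᵥ φ = θ • φ ∧ ∀ f, f ⬝ᵥ A *ᵥ f ≤ θ * (f ⬝ᵥ f) := by
  have hne : ∀ {B : Matrix n n ℝ} (hB : B.IsHermitian) (i : n), ⇑(hB.eigenvectorBasis i) ≠ 0 :=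
    fun hB i h => hB.eigenvectorBasis.orthonormal.ne_zero i (by ext j; exact congrFun h j)
  obtain ⟨i, hi⟩ := Finite.exists_max hA.eigenvalues
  refine ⟨hA.eigenvalues i, hA.eigenvectorBasis i, hne hA i, hA.mulVec_eigenvectorBasis i,
    fun f => ?_⟩
  set θ := hA.eigenvalues i
  have hB : (θ • (1 : Matrix n n ℝ) - A).IsHermitian := by
    have h1 : (θ • (1 : Matrix n n ℝ)).IsHermitian := by
      simp [Matrix.IsHermitian]
    exact h1.sub hA
  have hpos : (θ • (1 : Matrix n n ℝ) - A).PosSemidef := by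
    rw [hB.posSemidef_iff_eigenvalues_nonneg]
    intro j
    have h1 := hB.mulVec_eigenvectorBasis j
    rw [Matrix.sub_mulVec, Matrix.smul_mulVec, Matrix.one_mulVec] at h1
    have h2 : A *ᵥ ⇑(hB.eigenvectorBasis j) =
        (θ - hB.eigenvalues j) • ⇑(hB.eigenvectorBasis j) := by
      rw [sub_smul, ← h1]
      abel
    have h3 : Module.End.HasEigenvalue (Matrix.toLin' A) (θ - hB.eigenvalues j) :=
      Module.End.hasEigenvalue_of_hasEigenvector
        (Module.End.hasEigenvector_iff.2
          ⟨Module.End.mem_eigenspace_iff.2 (by rw [Matrix.toLin'_apply, h2]), hne hB j⟩)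
    have h4 := h3.mem_spectrum
    rw [Matrix.spectrum_toLin', hA.spectrum_real_eq_range_eigenvalues] at h4
    obtain ⟨k, hk⟩ := h4
    have := hi k
    simp only [Pi.zero_apply]
    linarith
  have h := hpos.dotProduct_mulVec_nonneg f
  simp only [star_trivial, Matrix.sub_mulVec, Matrix.smul_mulVec, Matrix.one_mulVec,
    dotProduct_sub, dotProduct_smul, smul_eq_mul] at h
  linarith

namespace SimpleGraph

open Matrix

variable {W : Type*} [Fintype W] (G : SimpleGraph W) [DecidableRel G.Adj]

theorem dotProduct_adjMatrix_mulVec_comm (f g : W → ℝ) :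
    f ⬝ᵥ G.adjMatrix ℝ *ᵥ g = g ⬝ᵥ G.adjMatrix ℝ *ᵥ f := by
  rw [dotProduct_mulVec, ← mulVec_transpose, transpose_adjMatrix, dotProduct_comm]

/-- The trace-type inequality at a vertex `w` of a triangle-free graph, when the quadratic form of
the adjacency matrix is at most `2` on the orthogonal complement of an eigenvector `z`. -/
theorem mul_degree_le_of_eigenvector (hG : G.CliqueFree 3) {z : W → ℝ} {θ S : ℝ} (hθ : 2 < θ)
    (hS : 0 < S) (hz : G.adjMatrix ℝ *ᵥ z = θ • z) (hzz : z ⬝ᵥ z = S)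
    (hperp : ∀ f, f ⬝ᵥ z = 0 → f ⬝ᵥ G.adjMatrix ℝ *ᵥ f ≤ 2 * (f ⬝ᵥ f)) (w : W) :
    S * (G.degree w * (G.degree w - 4)) ≤
      2 * (θ - 2) * (θ ^ 2 + G.degree w * θ + G.degree w) * z w ^ 2 := by
  classical
  set A := G.adjMatrix ℝ with hA
  set d : ℝ := (G.degree w : ℝ) with hd
  have hd0 : 0 ≤ d := Nat.cast_nonneg _
  set e : W → ℝ := Pi.single w 1 with he
  set a : W → ℝ := A *ᵥ e with ha
  have symm : ∀ f g, f ⬝ᵥ A *ᵥ g = g ⬝ᵥ A *ᵥ f := G.dotProduct_adjMatrix_mulVec_comm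
  have a_apply : ∀ v, a v = if G.Adj v w then 1 else 0 := fun v => by
    simp [ha, he, hA, adjMatrix_apply]
  have ee : e ⬝ᵥ e = 1 := by simp [he]
  have ez : e ⬝ᵥ z = z w := by simp [he]
  have ea : e ⬝ᵥ a = 0 := by simp [he, a_apply]
  have az : a ⬝ᵥ z = θ * z w := by
    rw [dotProduct_comm, ha, symm, hz, dotProduct_smul, ez, smul_eq_mul]
  have aa : a ⬝ᵥ a = d := by
    simp only [dotProduct, a_apply, mul_ite, mul_one, mul_zero, hd]
    rw [← Finset.sum_filter, Finset.sum_filter_of_ne (fun _ _ h => by simpa using h)]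
    simp [← G.card_neighborFinset_eq_degree, G.neighborFinset_eq_filter, G.adj_comm]
  have aAa : a ⬝ᵥ A *ᵥ a = 0 := by
    simp only [dotProduct, hA, adjMatrix_mulVec_apply, a_apply]
    refine Finset.sum_eq_zero fun v _ => ?_
    split_ifs with hv
    · rw [one_mul]
      refine Finset.sum_eq_zero fun x hx => if_neg fun hxw => ?_
      rw [mem_neighborFinset] at hx
      exact hG {v, x, w} (is3Clique_triple_iff.2 ⟨hx, hv, hxw⟩)
    · exact zero_mul _
  have eAa : e ⬝ᵥ A *ᵥ a = d := by rw [symm, ← ha, aa]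
  -- The test vector is `p • e + A e` made orthogonal to `z`; it is supported on the closed
  -- neighbourhood of `w` before projection, and triangle-freeness removes the form on `a = A e`.
  have test : ∀ p : ℝ, S * (2 * p * d - 2 * p ^ 2 - 2 * d) ≤ (θ - 2) * (z w * (p + θ)) ^ 2 := by
    intro p
    set t := z w * (p + θ) / S with ht
    have htS : t * S = z w * (p + θ) := div_mul_cancel₀ _ hS.ne'
    have hfz : (p • e + a - t • z) ⬝ᵥ z = 0 := by
      simp only [sub_dotProduct, add_dotProduct, smul_dotProduct, ez, az, hzz, smul_eq_mul, htS]
      ring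
    have h := hperp _ hfz
    have ze : z ⬝ᵥ e = z w := by rw [dotProduct_comm, ez]
    have za : z ⬝ᵥ a = θ * z w := by rw [dotProduct_comm, az]
    have zAa : z ⬝ᵥ A *ᵥ a = θ * (θ * z w) := by
      rw [symm, hz, dotProduct_smul, az, smul_eq_mul]
    have ae : a ⬝ᵥ e = 0 := by rw [dotProduct_comm, ea]
    simp only [mulVec_sub, mulVec_add, mulVec_smul, ← ha, hz, sub_dotProduct, add_dotProduct,
      smul_dotProduct, dotProduct_sub, dotProduct_add, dotProduct_smul, smul_eq_mul, ee, ez, ea, az,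
      aa, aAa, eAa, zAa, ze, za, hzz, ae] at h
    have h' : 2 * p * d - 2 * p ^ 2 - 2 * d ≤
        (θ - 2) * (2 * t * (z w * (p + θ)) - t * (t * S)) := by linarith
    rw [htS] at h'
    have h2 := mul_le_mul_of_nonneg_left h' hS.le
    have h3 : S * ((θ - 2) * (2 * t * (z w * (p + θ)) - t * (z w * (p + θ)))) =
        (θ - 2) * (t * S * (z w * (p + θ))) := by ring
    rw [h3, htS] at h2
    linarith
  have hq : 0 < 2 * θ + d := by linarith
  have hT : 0 < θ ^ 2 + d * θ + d := by positivity
  -- This p maximizes (2pd - 2p² - 2d)/(p + θ)².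
  have h := test (d * (θ + 2) / (2 * θ + d))
  have e1 : d * (θ + 2) / (2 * θ + d) + θ = 2 * (θ ^ 2 + d * θ + d) / (2 * θ + d) := by
    field_simp
    ring
  have e2 : 2 * (d * (θ + 2) / (2 * θ + d)) * d - 2 * (d * (θ + 2) / (2 * θ + d)) ^ 2 - 2 * d =
      2 * (d * (d - 4)) * (θ ^ 2 + d * θ + d) / (2 * θ + d) ^ 2 := by
    field_simp
    ring
  rw [e1, e2] at h
  have hc : 0 < 2 * (θ ^ 2 + d * θ + d) / (2 * θ + d) ^ 2 := by positivity
  refine le_of_mul_le_mul_left ?_ hc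
  calc _ = S * (2 * (d * (d - 4)) * (θ ^ 2 + d * θ + d) / (2 * θ + d) ^ 2) := by ring
    _ ≤ _ := h
    _ = _ := by field_simp

/-! ### Numerical Shearer sequence and the lower bound on the degree sum -/

/-- A convex sequence satisfying Shearer's recursive inequality. -/
noncomputable def shearerSeq : ℕ → ℝ
  | 0 => 1
  | 1 => 1 / 2
  | 2 => 2 / 5
  | 3 => 17 / 50
  | 4 => 2988 / 10000
  | d + 5 => (2683 - 238 * d) / 10000

theorem antitone_shearerSeq_sub : Antitone fun d => shearerSeq d - shearerSeq (d + 1) := by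
  refine antitone_nat_of_succ_le fun d => ?_
  match d with
  | 0 | 1 | 2 | 3 | 4 => norm_num [shearerSeq]
  | d + 5 =>
    simp only [shearerSeq]
    push_cast
    linarith

theorem shearerSeq_rec (d : ℕ) : (d + 1) * shearerSeq d ≤
    1 + d * (d - 1) * (shearerSeq (d - 1) - shearerSeq (d - 1 + 1)) := by
  match d with
  | 0 | 1 | 2 | 3 | 4 | 5 => norm_num [shearerSeq]
  | d + 6 =>
    have h : d + 6 - 1 = d + 5 := rfl
    rw [h]
    simp only [shearerSeq]
    have := Nat.cast_nonneg (α := ℝ) d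
    push_cast
    nlinarith

/-- The line carrying the tail from 5 on lies below the whole convex sequence; a linear bound sees
only the degree sum. -/
theorem le_shearerSeq (d : ℕ) : (3873 - 238 * d) / 10000 ≤ shearerSeq d := by
  match d with
  | 0 | 1 | 2 | 3 | 4 => norm_num [shearerSeq]
  | d + 5 =>
    simp only [shearerSeq]
    push_cast
    linarith

theorem le_sum_degree_of_indepSet_card_le (hG : G.CliqueFree 3) (hK : Fintype.card W = 105)
    (hind : ∀ I : Finset W, G.IsIndepSet I → I.card ≤ 27) : 574 ≤ ∑ w, (G.degree w : ℝ) := by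
  classical
  obtain ⟨I, -, hI, hle⟩ := G.exists_isIndepSet_sum_le hG antitone_shearerSeq_sub shearerSeq_rec
    Finset.univ
  have h1 : ∑ w, (3873 - 238 * (G.degree w : ℝ)) / 10000 ≤ I.card := by
    refine le_trans (Finset.sum_le_sum fun w _ => ?_) hle
    rw [← G.neighborFinset_eq_filter, G.card_neighborFinset_eq_degree]
    exact le_shearerSeq _
  have h2 : (I.card : ℝ) ≤ 27 := by exact_mod_cast hind I hI
  rw [← Finset.sum_div, Finset.sum_sub_distrib, ← Finset.mul_sum] at h1
  simp only [Finset.sum_const, Finset.card_univ, hK, nsmul_eq_mul] at h1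
  push_cast at h1
  linarith

end SimpleGraph

/-! ### Nonexistence of the graph on 105 vertices -/

namespace SimpleGraph

open Matrix

variable {W : Type*} [Fintype W] (G : SimpleGraph W) [DecidableRel G.Adj]

theorem one_dotProduct_adjMatrix_mulVec_one :
    (1 : W → ℝ) ⬝ᵥ G.adjMatrix ℝ *ᵥ (1 : W → ℝ) = ∑ w, (G.degree w : ℝ) := by
  simp [dotProduct, adjMatrix_mulVec_apply]

theorem one_dotProduct_adjMatrix_mulVec (z : W → ℝ) :
    (1 : W → ℝ) ⬝ᵥ G.adjMatrix ℝ *ᵥ z = ∑ w, (G.degree w : ℝ) * z w := by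
  rw [dotProduct_adjMatrix_mulVec_comm]
  simp [dotProduct, adjMatrix_mulVec_apply, mul_comm]

/-- An eigenvalue of the adjacency matrix is at most the maximum degree. -/
theorem eigenvalue_le_of_degree_le {k : ℕ} (hk : ∀ w, G.degree w ≤ k) {θ : ℝ} {φ : W → ℝ}
    (hφ : φ ≠ 0) (h : G.adjMatrix ℝ *ᵥ φ = θ • φ) : θ ≤ k := by
  obtain ⟨w, hw⟩ := Function.ne_iff.1 hφ
  have : Nonempty W := ⟨w⟩
  obtain ⟨u, hu⟩ := Finite.exists_max fun v => |φ v|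
  have hu0 : 0 < |φ u| := (abs_pos.2 hw).trans_le (hu w)
  have h1 : ∑ v ∈ G.neighborFinset u, φ v = θ * φ u := by
    rw [← adjMatrix_mulVec_apply, h, Pi.smul_apply, smul_eq_mul]
  refine le_of_mul_le_mul_right ?_ hu0
  calc θ * |φ u| ≤ |θ| * |φ u| := by gcongr; exact le_abs_self θ
    _ = |∑ v ∈ G.neighborFinset u, φ v| := by rw [h1, abs_mul]
    _ ≤ ∑ v ∈ G.neighborFinset u, |φ v| := Finset.abs_sum_le_sum_abs _ _
    _ ≤ ∑ v ∈ G.neighborFinset u, |φ u| := Finset.sum_le_sum fun v _ => hu v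
    _ = G.degree u * |φ u| := by simp
    _ ≤ k * |φ u| := by gcongr; exact hk u

variable {G} {z : W → ℝ} {θ S : ℝ}

/-- The quadratic form bound on the span of the all-one vector and an eigenvector `z`. -/
theorem quadraticForm_one_add_eigenvector_le
    (hM : ∀ f : W → ℝ, f ⬝ᵥ G.adjMatrix ℝ *ᵥ f ≤ 2 * (f ⬝ᵥ f) + (∑ w, f w) ^ 2 / 4)
    (hz : G.adjMatrix ℝ *ᵥ z = θ • z) (hzS : ∑ w, z w = S) (hzz : z ⬝ᵥ z = S) (α β : ℝ) :
    α ^ 2 * ∑ w, (G.degree w : ℝ) + 2 * (α * β * (θ * S)) + β ^ 2 * (θ * S) ≤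
      2 * (α ^ 2 * Fintype.card W + 2 * (α * β * S) + β ^ 2 * S) +
        (α * Fintype.card W + β * S) ^ 2 / 4 := by
  have h1 : (1 : W → ℝ) ⬝ᵥ 1 = Fintype.card W := by simp
  have h2 : (1 : W → ℝ) ⬝ᵥ z = S := by rw [one_dotProduct, hzS]
  have h3 : z ⬝ᵥ (1 : W → ℝ) = S := by rw [dotProduct_comm, h2]
  have h4 : z ⬝ᵥ G.adjMatrix ℝ *ᵥ (1 : W → ℝ) = θ * S := by
    rw [dotProduct_adjMatrix_mulVec_comm, hz, dotProduct_smul, h2, smul_eq_mul]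
  have h5 : ∑ w, (α • (1 : W → ℝ) + β • z) w = α * Fintype.card W + β * S := by
    simp [Finset.sum_add_distrib, ← Finset.mul_sum, hzS, mul_comm]
  have h := hM (α • (1 : W → ℝ) + β • z)
  rw [h5] at h
  simp only [mulVec_add, mulVec_smul, hz, add_dotProduct, smul_dotProduct, dotProduct_add,
    dotProduct_smul, smul_eq_mul, h1, h2, h3, h4, hzz, one_dotProduct_adjMatrix_mulVec_one] at h
  linarith

/-- Subtracting the multiple of `z` that makes the coordinate sum vanish kills the rank-one term,
and as θ ≥ 2 the subtracted part only helps. -/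
theorem quadraticForm_le_of_dotProduct_eigenvector_eq_zero
    (hM : ∀ f : W → ℝ, f ⬝ᵥ G.adjMatrix ℝ *ᵥ f ≤ 2 * (f ⬝ᵥ f) + (∑ w, f w) ^ 2 / 4)
    (hθ : 2 ≤ θ) (hS : 0 < S) (hz : G.adjMatrix ℝ *ᵥ z = θ • z) (hzS : ∑ w, z w = S)
    (hzz : z ⬝ᵥ z = S) {f : W → ℝ} (hf : f ⬝ᵥ z = 0) :
    f ⬝ᵥ G.adjMatrix ℝ *ᵥ f ≤ 2 * (f ⬝ᵥ f) := by
  set c := (∑ w, f w) / S with hc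
  have hzf : z ⬝ᵥ f = 0 := by rw [dotProduct_comm, hf]
  have h1 : ∑ w, (f - c • z) w = 0 := by
    simp [Finset.sum_sub_distrib, ← Finset.mul_sum, hzS, hc, hS.ne']
  have h2 : z ⬝ᵥ G.adjMatrix ℝ *ᵥ f = 0 := by
    rw [dotProduct_adjMatrix_mulVec_comm, hz, dotProduct_smul, hf, smul_zero]
  have h := hM (f - c • z)
  rw [h1] at h
  simp only [mulVec_sub, mulVec_smul, hz, sub_dotProduct, smul_dotProduct, dotProduct_sub,
    dotProduct_smul, smul_eq_mul, h2, hf, hzf, hzz] at h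
  have h3 : 0 ≤ (θ - 2) * (c ^ 2 * S) := by
    have : 0 ≤ θ - 2 := by linarith
    positivity
  linarith

variable (G) in
/-- There is no triangle-free graph on `105` vertices with maximum degree at most `20` and
independence number at most `27` whose adjacency form is bounded as in `hM`. -/
theorem false_of_card_eq_of_quadraticForm_le (hG : G.CliqueFree 3) (hK : Fintype.card W = 105)
    (hd : ∀ w, G.degree w ≤ 20) (hind : ∀ I : Finset W, G.IsIndepSet I → I.card ≤ 27)
    (hM : ∀ f : W → ℝ, f ⬝ᵥ G.adjMatrix ℝ *ᵥ f ≤ 2 * (f ⬝ᵥ f) + (∑ w, f w) ^ 2 / 4) :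
    False := by
  classical
  have hne : Nonempty W := Fintype.card_pos_iff.1 (by omega)
  have hA : (G.adjMatrix ℝ).IsHermitian := by
    rw [IsHermitian, conjTranspose_eq_transpose_of_trivial, transpose_adjMatrix]
  obtain ⟨θ, φ, hφ, hAφ, htop⟩ := hA.exists_eigenvector_forall_dotProduct_mulVec_le
  have hD := G.le_sum_degree_of_indepSet_card_le hG hK hind
  have hDθ : ∑ w, (G.degree w : ℝ) ≤ 105 * θ := by
    have h := htop 1
    rw [one_dotProduct_adjMatrix_mulVec_one] at h
    simp only [dotProduct_one, Pi.one_apply, Finset.sum_const, Finset.card_univ, hK,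
      nsmul_eq_mul] at h
    push_cast at h
    linarith
  have h2θ : 2 < θ := by linarith
  have hθ20 : θ ≤ 20 := by exact_mod_cast G.eigenvalue_le_of_degree_le hd hφ hAφ
  have hφφ : 0 < φ ⬝ᵥ φ := by
    have := dotProduct_star_self_pos_iff.2 hφ
    simpa using this
  set σ := ∑ w, φ w with hσ
  have hσ0 : σ ≠ 0 := by
    intro h0
    have h := hM φ
    rw [← hσ, h0, hAφ, dotProduct_smul, smul_eq_mul] at h
    nlinarith
  obtain ⟨S, hSdef⟩ : ∃ S, S = σ ^ 2 / (φ ⬝ᵥ φ) := ⟨_, rfl⟩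
  obtain ⟨z, hzdef⟩ : ∃ z, z = (σ / (φ ⬝ᵥ φ)) • φ := ⟨_, rfl⟩
  have hS : 0 < S := hSdef ▸ by positivity
  have hz : G.adjMatrix ℝ *ᵥ z = θ • z := by rw [hzdef, mulVec_smul, hAφ, smul_comm]
  have hzS : ∑ w, z w = S := by
    simp only [hzdef, Pi.smul_apply, smul_eq_mul, ← Finset.mul_sum, ← hσ, hSdef]
    ring
  have hzz : z ⬝ᵥ z = S := by
    simp only [hzdef, smul_dotProduct, dotProduct_smul, smul_eq_mul, hSdef]
    field_simp
  have hzz' : ∑ w, z w ^ 2 = S := by rw [← hzz]; simp [dotProduct, sq]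
  have hdz : ∑ w, (G.degree w : ℝ) * z w = θ * S := by
    rw [← one_dotProduct_adjMatrix_mulVec, hz, dotProduct_smul, one_dotProduct, hzS, smul_eq_mul]
  have hloc := G.mul_degree_le_of_eigenvector hG h2θ hS hz hzz fun f hf =>
    quadraticForm_le_of_dotProduct_eigenvector_eq_zero hM h2θ.le hS hz hzS hzz hf
  have hspan := quadraticForm_one_add_eigenvector_le hM hz hzS hzz
  rw [hK] at hspan
  push_cast at hspan
  have hv : 0 ≤ 105 - S := by
    have h : 0 ≤ ∑ w, (z w - 1) ^ 2 := Finset.sum_nonneg fun w _ => sq_nonneg _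
    have e : ∑ w, (z w - 1) ^ 2 = 105 - S := by
      simp only [sub_sq, Finset.sum_add_distrib, Finset.sum_sub_distrib, hzz', mul_one, one_pow,
        ← Finset.mul_sum, hzS, Finset.sum_const, Finset.card_univ, hK, nsmul_eq_mul]
      push_cast
      ring
    rwa [e] at h
  have hs : 0 ≤ S - 4 * (θ - 2) := by
    have h := hspan 0 1
    refine nonneg_of_mul_nonneg_right (a := S) ?_ hS
    linarith
  -- In the bound at 1 - (1 + t)z the coefficient of t² is proportional to S - 4(θ - 2). Were it 0,
  -- the linear term would force D < 0 for large t.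
  have hs' : 0 < S - 4 * (θ - 2) := by
    refine hs.lt_of_ne' fun h0 => ?_
    have hv' : 0 < 105 - S := by linarith
    set v := 105 - S with hvdef
    set D := ∑ w, (G.degree w : ℝ)
    set t := (θ * S + 2 * v + v ^ 2 / 4 + 1) * 2 / (S * v) with ht
    have htv : t * (S * v) = (θ * S + 2 * v + v ^ 2 / 4 + 1) * 2 :=
      div_mul_cancel₀ _ (by positivity)
    have h := hspan 1 (-(1 + t))
    have e : t ^ 2 * S * (S - 4 * (θ - 2)) = 0 := by rw [h0, mul_zero]
    have e2 : v = 105 - S := hvdef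
    rw [show (105 : ℝ) = v + S by linarith] at h
    nlinarith
  have hglob : ∀ t : ℝ, ∑ w, (G.degree w : ℝ) ≤ θ * S + 2 * (105 - S) -
      (θ - 2) * (2 * t * (105 - S) - t ^ 2 * (S - 4 * (θ - 2))) := by
    intro t
    set s := S - 4 * (θ - 2) with hsdef
    set v := 105 - S with hvdef
    set D := ∑ w, (G.degree w : ℝ)
    -- The optimal combination, corresponding to t = v/s; other t lose a square. Keeping t free
    -- leaves a bound linear in S.
    have h := hspan s (-(s + v))
    rw [show (105 : ℝ) = v + S by linarith,
      show S = s + 4 * (θ - 2) by linarith] at h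
    rw [show S = s + 4 * (θ - 2) by linarith]
    have h1 : s * (s * D) ≤ s * (s * (θ * (s + 4 * (θ - 2)) + 2 * v) - (θ - 2) * v ^ 2) := by
      linarith
    have h2 := le_of_mul_le_mul_left h1 hs'
    have h3 : 0 ≤ (θ - 2) * (v - t * s) ^ 2 := by
      have : 0 ≤ θ - 2 := by linarith
      positivity
    refine le_of_mul_le_mul_left ?_ hs'
    linarith
  rcases le_total 10 θ with h10 | h10
  · exact not_ten_le_of_moments hK (d := fun w => (G.degree w : ℝ))
      (fun w => ⟨Nat.cast_nonneg _, by exact_mod_cast hd w⟩) hS hzS hzz' hdz hloc hglob h10 hθ20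
  · exact not_le_ten_of_moments (d := fun w => (G.degree w : ℝ))
      (fun w => ⟨_, rfl, hd w⟩) hS hzz' hdz hloc hglob hD hDθ h10

end SimpleGraph

/-! ### Seidel matrices, switching and the gallery -/

namespace SeidelMatrix

open Matrix

variable {V : Type*} [DecidableEq V]

theorem switch_apply [Fintype V] (S : SeidelMatrix V) (U : Finset V) (i j : V) :
    (S.switch U).toMatrix i j =
      (if i ∈ U then 1 else -1) * S.toMatrix i j * (if j ∈ U then 1 else -1) := by
  simp only [switch, switchDiag, mul_diagonal, diagonal_mul]

theorem posSemidef_add_smul_one [Fintype V] {S : SeidelMatrix V} {t : ℝ}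
    (h : S.IsSmallestEigenvalue (-t)) : (S.toMatrix + t • (1 : Matrix V V ℝ)).PosSemidef := by
  have hS : S.toMatrix.IsHermitian := by
    rw [IsHermitian, conjTranspose_eq_transpose_of_trivial, S.symm.eq]
  have hB : (S.toMatrix + t • (1 : Matrix V V ℝ)).IsHermitian :=
    hS.add (by simp [IsHermitian])
  rw [hB.posSemidef_iff_eigenvalues_nonneg]
  intro j
  have h1 := hB.mulVec_eigenvectorBasis j
  rw [add_mulVec, smul_mulVec, one_mulVec] at h1
  have h2 : S.toMatrix *ᵥ ⇑(hB.eigenvectorBasis j) =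
      (hB.eigenvalues j - t) • ⇑(hB.eigenvectorBasis j) := by
    rw [sub_smul, ← h1]
    abel
  have h3 : ⇑(hB.eigenvectorBasis j) ≠ 0 := fun h =>
    hB.eigenvectorBasis.orthonormal.ne_zero j (by ext k; exact congrFun h k)
  have h4 := h.2 (Module.End.hasEigenvalue_of_hasEigenvector (Module.End.hasEigenvector_iff.2
    ⟨Module.End.mem_eigenspace_iff.2 (by rw [toLin'_apply, h2]), h3⟩))
  simp only [Pi.zero_apply]
  linarith

theorem posSemidef_switch_add_smul_one [Fintype V] {S : SeidelMatrix V} {t : ℝ}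
    (h : (S.toMatrix + t • (1 : Matrix V V ℝ)).PosSemidef) (U : Finset V) :
    ((S.switch U).toMatrix + t • (1 : Matrix V V ℝ)).PosSemidef := by
  have h1 := h.conjTranspose_mul_mul_same (switchDiag U)
  convert h1 using 1
  have h2 : (switchDiag U)ᴴ = switchDiag U := by simp [switchDiag, diagonal_transpose]
  have h3 : switchDiag U * switchDiag U = (1 : Matrix V V ℝ) := by
    rw [switchDiag, diagonal_mul_diagonal, ← diagonal_one]
    congr 1
    ext i
    split_ifs <;> norm_num
  rw [h2, Matrix.mul_add, Matrix.add_mul, Matrix.mul_smul, Matrix.smul_mul, Matrix.mul_one, h3]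
  rfl

theorem toMatrix_eq_of_graph (S : SeidelMatrix V) [DecidableRel S.graph.Adj] (i j : V) :
    S.toMatrix i j = 1 - (if i = j then 1 else 0) - 2 * if S.graph.Adj i j then 1 else 0 := by
  by_cases hij : i = j
  · subst hij
    simp [S.diag_eq_zero]
  · have h : S.graph.Adj i j ↔ S.toMatrix i j = -1 := Iff.rfl
    rcases S.off_diag i j hij with h1 | h1
    · have : ¬ S.graph.Adj i j := by rw [h, h1]; norm_num
      simp [h1, hij, this]
    · have : S.graph.Adj i j := h.2 h1
      simp only [h1, hij, this, if_true, if_false]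
      norm_num

/-- The quadratic form of the adjacency matrix of a set of vertices that are adjacent to neither
end of an edge `x₁x₂`, when the smallest eigenvalue is at least `-5`. -/
theorem dotProduct_adjMatrix_mulVec_le {T : SeidelMatrix V} [DecidableRel T.graph.Adj]
    (hT : (T.toMatrix + (5 : ℝ) • (1 : Matrix V V ℝ)).PosSemidef) {x₁ x₂ : V}
    (hadj : T.graph.Adj x₁ x₂) (t : Finset V)
    (ht : ∀ y ∈ t, ¬ T.graph.Adj y x₁ ∧ ¬ T.graph.Adj y x₂) (f : ↥(t : Set V) → ℝ) :
    f ⬝ᵥ (T.graph.induce (t : Set V)).adjMatrix ℝ *ᵥ f ≤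
      2 * (f ⬝ᵥ f) + (∑ w, f w) ^ 2 / 4 := by
  set M := T.toMatrix + (5 : ℝ) • (1 : Matrix V V ℝ) with hMdef
  have hM : ∀ i j, M i j = 1 + 4 * (if i = j then 1 else 0) -
      2 * if T.graph.Adj i j then 1 else 0 := by
    intro i j
    rw [hMdef, Matrix.add_apply, Matrix.smul_apply, T.toMatrix_eq_of_graph, Matrix.one_apply,
      smul_eq_mul]
    ring
  have h12 : x₁ ≠ x₂ := hadj.ne
  have hne : ∀ y : (t : Set V), (y : V) ≠ x₁ ∧ (y : V) ≠ x₂ := fun y =>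
    ⟨fun h => (ht y y.2).2 (h ▸ hadj), fun h => (ht y y.2).1 (h ▸ hadj.symm)⟩
  set h := ∑ w, f w with hh
  -- Weight -h/4 on each of `x₁`, `x₂` minimizes the form for given f.
  have hpos := (hT.submatrix (Sum.elim (fun w : (t : Set V) => (w : V)) ![x₁, x₂])
    ).dotProduct_mulVec_nonneg (Sum.elim f ![-h / 4, -h / 4])
  have e1 : ∀ y : (t : Set V), M y x₁ = 1 ∧ M y x₂ = 1 ∧ M x₁ y = 1 ∧ M x₂ y = 1 := fun y => by
    have h1 := ht y y.2
    simp [hM, hne y, (hne y).1.symm, (hne y).2.symm, h1, T.graph.adj_comm x₁ y,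
      T.graph.adj_comm x₂ y]
  have e2 : M x₁ x₁ = 5 ∧ M x₂ x₂ = 5 ∧ M x₁ x₂ = -1 ∧ M x₂ x₁ = -1 := by
    simp only [hM, h12, h12.symm, hadj, hadj.symm, SimpleGraph.irrefl, if_true, if_false]
    norm_num
  have e3 : ∑ y : (t : Set V), f y * ∑ y' : (t : Set V), M y y' * f y' =
      h ^ 2 + 4 * (f ⬝ᵥ f) - 2 * (f ⬝ᵥ (T.graph.induce (t : Set V)).adjMatrix ℝ *ᵥ f) := by
    have : ∀ y : (t : Set V), ∑ y' : (t : Set V), M y y' * f y' =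
        h + 4 * f y - 2 * ((T.graph.induce (t : Set V)).adjMatrix ℝ *ᵥ f) y := by
      intro y
      simp only [hM, mulVec, dotProduct, SimpleGraph.adjMatrix_apply, SimpleGraph.comap_adj,
        Function.Embedding.subtype_apply, sub_mul, add_mul, one_mul, Finset.sum_sub_distrib,
        Finset.sum_add_distrib, mul_assoc, ← Finset.mul_sum, ite_mul, zero_mul, hh]
      simp
    simp only [this, dotProduct, mul_sub, mul_add, Finset.sum_sub_distrib, Finset.sum_add_distrib,
      ← Finset.sum_mul, mul_left_comm (f _), ← Finset.mul_sum, hh, sq]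
  simp only [star_trivial, dotProduct, mulVec, Fintype.sum_sum_type, Sum.elim_inl, Sum.elim_inr,
    submatrix_apply, Fin.sum_univ_two, cons_val_zero, cons_val_one, e1, e2, one_mul, mul_add,
    Finset.sum_add_distrib, ← Finset.sum_mul, ← hh, e3] at hpos
  simp only [dotProduct, mulVec]
  linarith

/-- The copy of a vertex in the switching graph that corresponds to switching at `U`. -/
def switchingLift (U : Finset V) (i : V) : V ⊕ V := if i ∈ U then .inl i else .inr i

theorem switchingLift_injective (U : Finset V) : Function.Injective (switchingLift U) := by
  intro i j h
  unfold switchingLift at h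
  split_ifs at h <;> simpa using h

variable [Fintype V] (S : SeidelMatrix V) (U : Finset V)

theorem switchingGraph_adj_switchingLift {i j : V} :
    S.switchingGraph.Adj (switchingLift U i) (switchingLift U j) ↔
      (S.switch U).graph.Adj i j := by
  change S.double.toMatrix _ _ = -1 ↔ (S.switch U).toMatrix i j = -1
  have hd : i = j → S.toMatrix i j = 0 := fun h => h ▸ S.diag_eq_zero i
  rw [switch_apply]
  unfold switchingLift double
  by_cases hi : i ∈ U <;> by_cases hj : j ∈ U <;>
    by_cases hij : i = j <;> simp_all

/-- Passing to the other copy of `j` flips the sign of the entry, so nonneighbours become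
neighbours. -/
theorem switchingGraph_adj_switchingLift_compl {i j : V} (hij : i ≠ j)
    (h : ¬ (S.switch U).graph.Adj i j) :
    S.switchingGraph.Adj (switchingLift U i) (switchingLift Uᶜ j) := by
  change S.double.toMatrix _ _ = -1
  change ¬ (S.switch U).toMatrix i j = -1 at h
  rw [switch_apply] at h
  unfold switchingLift double
  rcases S.off_diag i j hij with h1 | h1 <;>
    by_cases hi : i ∈ U <;> by_cases hj : j ∈ U <;> simp_all

theorem switch_compl_graph : (S.switch Uᶜ).graph = (S.switch U).graph := by
  ext i j
  change (S.switch Uᶜ).toMatrix i j = -1 ↔ (S.switch U).toMatrix i j = -1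
  rw [switch_apply, switch_apply]
  by_cases hi : i ∈ U <;> by_cases hj : j ∈ U <;> simp [hi, hj]

theorem card_le_indepNum {I : Finset V} (hI : (S.switch U).graph.IsIndepSet I) :
    I.card ≤ S.indepNum := by
  have h : S.switchingGraph.IsIndepSet (I.map ⟨_, switchingLift_injective U⟩ : Finset (V ⊕ V)) := by
    rintro _ hi' _ hj' hij
    obtain ⟨i, hi, rfl⟩ := Finset.mem_map.1 hi'
    obtain ⟨j, hj, rfl⟩ := Finset.mem_map.1 hj'
    simp only [Function.Embedding.coeFn_mk, switchingGraph_adj_switchingLift]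
    exact hI hi hj fun h => hij (by rw [h])
  simpa [indepNum] using h.card_le_indepNum

end SeidelMatrix

/-- A gallery of maximum valency at most `20` has at most `104` vertices, so equality never holds in
the bound `105`. -/
theorem card_gallerySet_lt [Fintype V] [DecidableEq V] {S : SeidelMatrix V}
    (hmin : S.IsSmallestEigenvalue (-5)) (hα : S.indepNum ≤ 28) (hω : S.cliqueNum = 4)
    {H : SimpleGraph V} [DecidableRel H.Adj] (hH : H ∈ S.switchingClass)
    {x₁ x₂ : V} (hadj : H.Adj x₁ x₂) (hb : (gallery H x₁ x₂).maxDegree ≤ 20) :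
    (gallerySet H x₁ x₂).card < 105 := by
  by_contra! hcard
  obtain ⟨U, rfl⟩ := hH
  obtain ⟨t, htsub, htcard⟩ := Finset.exists_subset_card_eq hcard
  have ht : ∀ y ∈ t, ¬ (S.switch U).graph.Adj y x₁ ∧ ¬ (S.switch U).graph.Adj y x₂ :=
    fun y hy => by simpa [gallerySet] using htsub hy
  have hne : ∀ y ∈ t, y ≠ x₁ ∧ y ≠ x₂ := fun y hy =>
    ⟨fun h => (ht y hy).2 (h ▸ hadj), fun h => (ht y hy).1 (h ▸ hadj.symm)⟩
  refine ((S.switch U).graph.induce (t : Set V)).false_of_card_eq_of_quadraticForm_le ?_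
    (by simpa using htcard) (fun w => ?_) (fun I hI => ?_)
    (SeidelMatrix.dotProduct_adjMatrix_mulVec_le
      (SeidelMatrix.posSemidef_switch_add_smul_one
        (SeidelMatrix.posSemidef_add_smul_one hmin) U) hadj t ht)
  · intro s hs
    obtain ⟨a, b, c, hab, hac, hbc, rfl⟩ := SimpleGraph.is3Clique_iff.1 hs
    have h₁ : ∀ y ∈ t, S.switchingGraph.Adj (SeidelMatrix.switchingLift Uᶜ x₁)
        (SeidelMatrix.switchingLift U y) := fun y hy =>
      (S.switchingGraph_adj_switchingLift_compl U (hne y hy).1 (ht y hy).1).symm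
    have h₂ : ∀ y ∈ t, S.switchingGraph.Adj (SeidelMatrix.switchingLift Uᶜ x₂)
        (SeidelMatrix.switchingLift U y) := fun y hy =>
      (S.switchingGraph_adj_switchingLift_compl U (hne y hy).2 (ht y hy).2).symm
    have h₁₂ : S.switchingGraph.Adj (SeidelMatrix.switchingLift Uᶜ x₂)
        (SeidelMatrix.switchingLift Uᶜ x₁) := by
      rw [S.switchingGraph_adj_switchingLift, S.switch_compl_graph]
      exact hadj.symm
    have lift : ∀ {i j : (t : Set V)}, ((S.switch U).graph.induce (t : Set V)).Adj i j →
        S.switchingGraph.Adj (SeidelMatrix.switchingLift U i) (SeidelMatrix.switchingLift U j) :=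
      fun h => (S.switchingGraph_adj_switchingLift U).2 h
    -- The 5-clique: the triangle in the copy for `U`, the edge `x₁x₂` in the copy for `Uᶜ`.
    have hc := ((SimpleGraph.is3Clique_triple_iff.2 ⟨lift hab, lift hac, lift hbc⟩).insert
      (a := SeidelMatrix.switchingLift Uᶜ x₁) (by
        simp only [Finset.mem_insert, Finset.mem_singleton, forall_eq_or_imp, forall_eq]
        exact ⟨h₁ a a.2, h₁ b b.2, h₁ c c.2⟩)).insert
      (a := SeidelMatrix.switchingLift Uᶜ x₂) (by
        simp only [Finset.mem_insert, Finset.mem_singleton, forall_eq_or_imp, forall_eq]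
        exact ⟨h₁₂, h₂ a a.2, h₂ b b.2, h₂ c c.2⟩)
    have h5 := hc.isClique.card_le_cliqueNum
    rw [hc.card_eq] at h5
    rw [SeidelMatrix.cliqueNum] at hω
    omega
  · exact (((S.switch U).graph.induceHomOfLE (Finset.coe_subset.2 htsub)).toCopy.degree_le w).trans
      (((gallery (S.switch U).graph x₁ x₂).degree_le_maxDegree _).trans hb)
  · have hx : x₁ ∉ I.map (.subtype _) := by
      intro h
      obtain ⟨y, -, hy⟩ := Finset.mem_map.1 h
      exact (hne y y.2).1 hy
    have h : (S.switch U).graph.IsIndepSet (insert x₁ (I.map (.subtype _)) : Finset V) := by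
      have : Std.Symm fun v w => ¬ (S.switch U).graph.Adj v w := ⟨fun _ _ h h' => h h'.symm⟩
      rw [Finset.coe_insert, SimpleGraph.IsIndepSet, Set.pairwise_insert_of_symm]
      refine ⟨?_, fun z hz _ => ?_⟩
      · rintro _ hy _ hz hyz
        obtain ⟨y, hy', rfl⟩ := Finset.mem_map.1 hy
        obtain ⟨z, hz', rfl⟩ := Finset.mem_map.1 hz
        exact hI hy' hz' fun h => hyz (by rw [h])
      · obtain ⟨z, -, rfl⟩ := Finset.mem_map.1 hz
        exact fun h => (ht z z.2).1 h.symm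
    have h28 := (SeidelMatrix.card_le_indepNum S U h).trans hα
    rw [Finset.card_insert_of_notMem hx, Finset.card_map] at h28
    omega

theorem theorem105 {n : ℕ} (hn : 277 ≤ n) (S : SeidelMatrix (Fin n))
    (hmin : S.IsSmallestEigenvalue (-5)) (hα : S.indepNum ≤ 28) (hω : S.cliqueNum = 4)
    (H : SimpleGraph (Fin n)) [DecidableRel H.Adj] (hH : H ∈ S.switchingClass)
    (x₁ x₂ : Fin n) (hadj : H.Adj x₁ x₂) (hcommon : H.commonNeighbors x₁ x₂ = ∅)
    (hb : (gallery H x₁ x₂).maxDegree ≤ 20) :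
    (gallerySet H x₁ x₂).card ≤ 105 ∧
    ((gallerySet H x₁ x₂).card = 105 →
      ∃ u v, (gallery H x₁ x₂).Adj u v ∧
        (gallery H x₁ x₂).degree u = 20 ∧ (gallery H x₁ x₂).degree v = 20) :=
  have h := card_gallerySet_lt hmin hα hω hH hadj hb
  ⟨h.le, fun h' => absurd h' h.ne⟩
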